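/- Let $\Gamma$ be a discrete group acting by homeomorphisms on a locally compact Hausdorff space $X$, and suppose that the action is not free, i.e. $sx=x$ for some $x\in X$ and some $s\in\Gamma\setminus\{e\}$. All spaces below are locally compact Hausdorff, and a factor map between $\Gamma$-spaces is a $\Gamma$-equivariant quotient map; it is proper if preimages of compact sets are compact. Then there are a free action of $\Gamma$ by homeomorphisms on a locally compact Hausdorff space $Y$ and a proper factor map $\pi\colon Y\to X$ with the following property. Regard $C_0(X)$ as a $\Gamma$-invariant C*-subalgebra of $C_0(Y)$ via $f\mapsto f\circ\pi$, so that $C_0(X)\rtimes_{\mathrm r}\Gamma\subset C_0(Y)\rtimes_{\mathrm r}\Gamma$ (reduced crossed products). There is a C*-algebra $A$ with $$C_0(X)\rtimes_{\mathrm r}\Gamma\subset A\subset C_0(Y)\rtimes_{\mathrm r}\Gamma$$ such that $A\neq C_0(Z)\rtimes_{\mathrm r}\Gamma$ for every intermediate extension $Z$ of $\pi$, that is, for every locally compact Hausdorff $\Gamma$-space $Z$ with factor maps $p\colon Y\to Z$ and $q\colon Z\to X$ satisfying $q\circ p=\pi$, where $C_0(Z)$ is regarded as a subalgebra of $C_0(Y)$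 via $f\mapsto f\circ p$. -/

import Mathlib

open scoped ZeroAtInfty

universe u v

noncomputable section

namespace CrossedProduct

/-- An action is free if no element other than the identity fixes a point. -/
def IsFreeAction (Γ Y : Type*) [Group Γ] [MulAction Γ Y] : Prop :=
  ∀ (s : Γ) (y : Y), s • y = y → s = 1

/-- A factor map between two `Γ`-spaces: an equivariant (topological) quotient map. -/
structure IsFactorMap (Γ : Type*) {Y X : Type*} [Group Γ] [TopologicalSpace Y]
    [TopologicalSpace X] [MulAction Γ Y] [MulAction Γ X] (π : Y → X) : Prop where
  isQuotientMap : Topology.IsQuotientMap π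
  equivariant : ∀ (s : Γ) (y : Y), π (s • y) = s • π y

/-- A proper factor map: preimages of compact sets are compact. -/
structure IsProperFactorMap (Γ : Type*) {Y X : Type*} [Group Γ] [TopologicalSpace Y]
    [TopologicalSpace X] [MulAction Γ Y] [MulAction Γ X] (π : Y → X) : Prop
    extends IsFactorMap Γ π where
  isCompact_preimage : ∀ K : Set X, IsCompact K → IsCompact (π ⁻¹' K)

/-- The Hilbert space `ℓ²(Γ) ⊗ ℓ²(Y) = ℓ²(Γ × Y)`. -/
abbrev L2 (Γ Y : Type*) : Type _ := lp (fun _ : Γ × Y => ℂ) 2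

/-- The representation of `C₀(Y)` in the left regular representation of the system `Γ ↷ C₀(Y)`
induced from the faithful representation of `C₀(Y)` on `ℓ²(Y)` by multiplication:
`(f ξ)(t, y) = (t⁻¹ · f)(y) ξ(t, y) = f (t y) ξ(t, y)`. -/
def mulOp (Γ : Type*) {Y : Type*} [Group Γ] [TopologicalSpace Y] [MulAction Γ Y]
    (f : C₀(Y, ℂ)) : L2 Γ Y →L[ℂ] L2 Γ Y :=
  lp.mapCLM 2 (fun i : Γ × Y => f (i.1 • i.2) • ContinuousLinearMap.id ℂ ℂ) (K := ‖f‖)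
    (norm_nonneg f)
    (fun i => by
      rw [norm_smul]
      simpa using f.toBCF.norm_coe_le_norm (i.1 • i.2))

theorem mulOp_apply (Γ : Type*) {Y : Type*} [Group Γ] [TopologicalSpace Y] [MulAction Γ Y]
    (f : C₀(Y, ℂ)) (ξ : L2 Γ Y) (t : Γ) (y : Y) :
    mulOp Γ f ξ (t, y) = f (t • y) * ξ (t, y) :=
  rfl

theorem memlp_translate {Γ Y : Type*} [Group Γ] (s : Γ) (ξ : L2 Γ Y) :
    Memℓp (fun i : Γ × Y => ξ (s⁻¹ * i.1, i.2)) 2 :=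
  memℓp_gen ((((lp.memℓp ξ).summable (by simp)).comp_injective
    ((Equiv.mulLeft s⁻¹).prodCongr (Equiv.refl Y)).injective))

/-- The unitary `λ_s ⊗ 1` implementing `s`: `(u_s ξ)(t, y) = ξ(s⁻¹ t, y)`. -/
def transOp {Γ : Type*} (Y : Type*) [Group Γ] (s : Γ) : L2 Γ Y →L[ℂ] L2 Γ Y :=
  LinearMap.mkContinuous
    { toFun := fun ξ => ⟨fun i : Γ × Y => ξ (s⁻¹ * i.1, i.2), memlp_translate s ξ⟩
      map_add' := fun _ _ => rfl
      map_smul' := fun _ _ => rfl } 1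
    (fun ξ => by
      refine lp.norm_le_of_tsum_le (by simp) (by positivity) ?_
      rw [one_mul, lp.norm_rpow_eq_tsum (by simp)]
      exact le_of_eq (((Equiv.mulLeft s⁻¹).prodCongr (Equiv.refl Y)).tsum_eq
        (fun i : Γ × Y => ‖ξ i‖ ^ (2 : ENNReal).toReal)))

theorem transOp_apply {Γ : Type*} (Y : Type*) [Group Γ] (s : Γ) (ξ : L2 Γ Y) (t : Γ) (y : Y) :
    transOp Y s ξ (t, y) = ξ (s⁻¹ * t, y) :=
  rfl

/-- The copy of `C₀(Z)` in `C₀(Y)` given by a map `p : Y → Z`, that is `{f ∘ p : f ∈ C₀(Z)}`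
(for a proper continuous `p` every `f ∘ p` is in `C₀(Y)`). -/
def pullback {Y Z : Type*} [TopologicalSpace Y] [TopologicalSpace Z] (p : Y → Z) :
    NonUnitalStarSubalgebra ℂ C₀(Y, ℂ) where
  carrier := {g | ∃ f : C₀(Z, ℂ), ∀ y, g y = f (p y)}
  add_mem' := by
    rintro _ _ ⟨f, hf⟩ ⟨f', hf'⟩
    exact ⟨f + f', fun y => by simp [hf, hf']⟩
  zero_mem' := ⟨0, fun y => by simp⟩
  mul_mem' := by
    rintro _ _ ⟨f, hf⟩ ⟨f', hf'⟩
    exact ⟨f * f', fun y => by simp [hf, hf']⟩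
  smul_mem' := by
    rintro c _ ⟨f, hf⟩
    exact ⟨c • f, fun y => by simp [hf]⟩
  star_mem' := by
    rintro _ ⟨f, hf⟩
    exact ⟨star f, fun y => by simp [hf]⟩

/-- The reduced crossed product `D ⋊_r Γ` of a `Γ`-invariant C*-subalgebra `D` of `C₀(Y)`: the
C*-algebra generated by the operators `f u_s`, `f ∈ D`, `s ∈ Γ`, in the regular representation
induced from the faithful representation `D ⊆ C₀(Y) ⊆ B(ℓ²(Y))`. For `D ⊆ D'` it realizes the
canonical inclusion `D ⋊_r Γ ⊆ D' ⋊_r Γ`. -/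
def reducedCrossedProduct (Γ : Type*) {Y : Type*} [Group Γ] [TopologicalSpace Y] [MulAction Γ Y]
    (D : NonUnitalStarSubalgebra ℂ C₀(Y, ℂ)) :
    NonUnitalStarSubalgebra ℂ (L2 Γ Y →L[ℂ] L2 Γ Y) :=
  (NonUnitalStarAlgebra.adjoin ℂ
    {T | ∃ f ∈ D, ∃ s : Γ, T = mulOp Γ f * transOp Y s}).topologicalClosure

end CrossedProduct

end

/-!
Let `s ≠ 1` fix `x`. Over `x` choose `y₁`, `y₂` and a function `p` on `Y` which vanishes on the
orbit of `y₁` and is the indicator function of `⟨s⟩ y₂` on the orbit of `y₂`; let `A` be generated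
by `C₀(X) ⋊ Γ` and `p - p u_s`. If `A = D ⋊ Γ`, then `A` contains the conditional expectation `p`
of `p - p u_s`. To see that it does not, consider long partial sums along the cosets `h⟨s⟩` in the
copies of `ℓ²(Γ)` over `y₁` and `y₂`. On these, both `C₀(X) ⋊ Γ` and `p - p u_s` act asymptotically
as on `ℂ[Γ/⟨s⟩]`, and in the same way over `y₁` and over `y₂`: the functions from `X` do not
separate the two points, and `p - p u_s` acts as zero because `s` fixes the coset `⟨s⟩`. But `p`
acts as zero over `y₁` and as the projection onto the coset `⟨s⟩` over `y₂`.
-/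

noncomputable section

namespace CrossedProduct

section Operators

variable {Γ Y : Type*}

/-- The basis vector `δ_{(t, y)}` of `ℓ²(Γ × Y)`. -/
def basisVec (t : Γ) (y : Y) : L2 Γ Y :=
  open Classical in lp.single 2 (t, y) (1 : ℂ)

open Classical in
theorem basisVec_apply (t : Γ) (y : Y) (i : Γ × Y) :
    basisVec t y i = if i = (t, y) then 1 else 0 := by
  rw [basisVec, lp.single_apply, Pi.single_apply]

theorem norm_basisVec (t : Γ) (y : Y) : ‖basisVec t y‖ = 1 := by
  classical
  simpa only [norm_one, basisVec] using
    lp.norm_single (E := fun _ : Γ × Y => ℂ) (p := 2) (by norm_num) (t, y) 1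

open Classical in
theorem inner_basisVec_basisVec (t t' : Γ) (y : Y) :
    inner ℂ (basisVec t y) (basisVec t' y) = if t = t' then 1 else 0 := by
  have h : inner ℂ (basisVec t y) (basisVec t' y) = inner ℂ (1 : ℂ) (basisVec t' y (t, y)) :=
    lp.inner_single_left (𝕜 := ℂ) (G := fun _ : Γ × Y => ℂ) (t, y) 1 (basisVec t' y)
  simpa [basisVec_apply] using h

variable [Group Γ]

theorem transOp_basisVec (s t : Γ) (y : Y) :
    transOp Y s (basisVec t y) = basisVec (s * t) y := by
  classical
  ext ⟨r, z⟩
  rw [transOp_apply, basisVec_apply, basisVec_apply]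
  simp only [Prod.mk.injEq, inv_mul_eq_iff_eq_mul]

theorem transOp_one : transOp Y (1 : Γ) = 1 := by
  ext ξ ⟨r, z⟩
  simp [transOp_apply]

theorem transOp_mul_transOp (s t : Γ) : transOp Y s * transOp Y t = transOp Y (s * t) := by
  ext ξ ⟨r, z⟩
  simp only [mul_apply_eq_comp, transOp_apply, mul_inv_rev, mul_assoc]

theorem star_transOp (s : Γ) : star (transOp Y s) = transOp Y s⁻¹ := by
  rw [ContinuousLinearMap.star_eq_adjoint, eq_comm, ContinuousLinearMap.eq_adjoint_iff]
  intro ξ η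
  rw [lp.inner_eq_tsum, lp.inner_eq_tsum,
    ← ((Equiv.mulLeft s⁻¹).prodCongr (Equiv.refl Y)).tsum_eq]
  exact tsum_congr fun ⟨t, y⟩ => by simp [transOp_apply]

variable [TopologicalSpace Y] [MulAction Γ Y]

theorem mulOp_basisVec (f : C₀(Y, ℂ)) (t : Γ) (y : Y) :
    mulOp Γ f (basisVec t y) = f (t • y) • basisVec t y := by
  ext ⟨r, z⟩
  by_cases h : (r, z) = (t, y)
  · obtain ⟨rfl, rfl⟩ := Prod.mk.inj h
    rfl
  · simp [mulOp_apply, basisVec_apply, h]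

theorem mulOp_sub (f g : C₀(Y, ℂ)) : mulOp Γ (f - g) = mulOp Γ f - mulOp Γ g := by
  ext ξ ⟨r, z⟩
  exact sub_mul (f (r • z)) (g (r • z)) (ξ (r, z))

theorem mulOp_mul_mulOp (f g : C₀(Y, ℂ)) : mulOp Γ f * mulOp Γ g = mulOp Γ (f * g) := by
  ext ξ ⟨r, z⟩
  exact (mul_assoc (f (r • z)) (g (r • z)) (ξ (r, z))).symm

theorem star_mulOp (f : C₀(Y, ℂ)) : star (mulOp Γ f) = mulOp Γ (star f) := by
  rw [ContinuousLinearMap.star_eq_adjoint, eq_comm, ContinuousLinearMap.eq_adjoint_iff]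
  intro ξ η
  rw [lp.inner_eq_tsum, lp.inner_eq_tsum]
  exact tsum_congr fun ⟨t, y⟩ => by
    simp only [RCLike.inner_apply, mulOp_apply, ZeroAtInftyContinuousMap.star_apply, map_mul,
      RCLike.star_def, RCLike.conj_conj]
    ring

theorem norm_mulOp_le (f : C₀(Y, ℂ)) : ‖mulOp Γ f‖ ≤ ‖f‖ :=
  lp.norm_mapCLM_le ..

variable [ContinuousConstSMul Γ Y]

/-- The translate `y ↦ f (g y)` of a function vanishing at infinity, that is `g⁻¹ · f` for the
action of `Γ` on `C₀(Y)`. -/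
def translate (g : Γ) (f : C₀(Y, ℂ)) : C₀(Y, ℂ) :=
  f.comp (Homeomorph.smul g).toCocompactMap

theorem transOp_mul_mulOp (s : Γ) (f : C₀(Y, ℂ)) :
    transOp Y s * mulOp Γ f = mulOp Γ (translate s⁻¹ f) * transOp Y s := by
  ext ξ ⟨r, z⟩
  change f ((s⁻¹ * r) • z) * _ = f (s⁻¹ • r • z) * _
  rw [mul_smul]
  rfl

theorem translate_mem_pullback {Z : Type*} [TopologicalSpace Z] [MulAction Γ Z]
    [ContinuousConstSMul Γ Z] {p : Y → Z} (hp : ∀ (s : Γ) (y : Y), p (s • y) = s • p y) (g : Γ)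
    {f : C₀(Y, ℂ)} (hf : f ∈ pullback p) : translate g f ∈ pullback p := by
  obtain ⟨k, hk⟩ := hf
  exact ⟨translate g k, fun y => (hk (g • y)).trans (congrArg k (hp g y))⟩

end Operators

section Expectation

variable {Γ Y : Type*} [Group Γ]

/-- The matrix coefficients `⟨T δ_{(1, y)}, δ_{(1, y)}⟩` as a function of `y`. On the reduced
crossed product this is the canonical conditional expectation onto `C₀(Y)`. -/
def diagonal (Γ Y : Type*) [Group Γ] : (L2 Γ Y →L[ℂ] L2 Γ Y) →ₗ[ℂ] (Y → ℂ) where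
  toFun T y := T (basisVec 1 y) (1, y)
  map_add' _ _ := rfl
  map_smul' _ _ := rfl

theorem norm_diagonal_le (T : L2 Γ Y →L[ℂ] L2 Γ Y) (y : Y) : ‖diagonal Γ Y T y‖ ≤ ‖T‖ :=
  calc ‖diagonal Γ Y T y‖ ≤ ‖T (basisVec 1 y)‖ := lp.norm_apply_le_norm two_ne_zero _ _
    _ ≤ ‖T‖ * ‖basisVec (1 : Γ) y‖ := T.le_opNorm _
    _ = ‖T‖ := by rw [norm_basisVec, mul_one]

variable [TopologicalSpace Y] [MulAction Γ Y] {D : NonUnitalStarSubalgebra ℂ C₀(Y, ℂ)}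

theorem diagonal_mulOp (f : C₀(Y, ℂ)) : diagonal Γ Y (mulOp Γ f) = f := by
  ext y
  change mulOp Γ f (basisVec 1 y) (1, y) = f y
  simp [mulOp_apply, basisVec_apply]

theorem diagonal_mulOp_mul_transOp (f : C₀(Y, ℂ)) {s : Γ} (hs : s ≠ 1) :
    diagonal Γ Y (mulOp Γ f * transOp Y s) = 0 := by
  ext y
  change mulOp Γ f (transOp Y s (basisVec 1 y)) (1, y) = 0
  simp [mulOp_apply, transOp_basisVec, basisVec_apply, hs.symm]

/-- The operators `f u_s`, `f ∈ D`, `s ∈ Γ`, which generate the reduced crossed product of `D`. -/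
def monomials (Γ : Type*) {Y : Type*} [Group Γ] [TopologicalSpace Y] [MulAction Γ Y]
    (D : NonUnitalStarSubalgebra ℂ C₀(Y, ℂ)) : Set (L2 Γ Y →L[ℂ] L2 Γ Y) :=
  {T | ∃ f ∈ D, ∃ s : Γ, T = mulOp Γ f * transOp Y s}

theorem mulOp_mul_transOp_mem_reducedCrossedProduct {f : C₀(Y, ℂ)} (hf : f ∈ D) (s : Γ) :
    mulOp Γ f * transOp Y s ∈ reducedCrossedProduct Γ D :=
  NonUnitalStarSubalgebra.le_topologicalClosure _
    (NonUnitalStarAlgebra.subset_adjoin ℂ _ ⟨f, hf, s, rfl⟩)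

theorem mulOp_mem_reducedCrossedProduct {f : C₀(Y, ℂ)} (hf : f ∈ D) :
    mulOp Γ f ∈ reducedCrossedProduct Γ D := by
  simpa only [transOp_one, mul_one] using mulOp_mul_transOp_mem_reducedCrossedProduct hf (1 : Γ)

variable [ContinuousConstSMul Γ Y]

theorem adjoin_monomials_le_span (hD : ∀ (g : Γ), ∀ f ∈ D, translate g f ∈ D) :
    (NonUnitalStarAlgebra.adjoin ℂ (monomials Γ D)).toSubmodule ≤
      Submodule.span ℂ (monomials Γ D) := by
  have hmul : ∀ {S T}, S ∈ monomials Γ D → T ∈ monomials Γ D → S * T ∈ monomials Γ D := by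
    rintro _ _ ⟨f, hf, s, rfl⟩ ⟨g, hg, t, rfl⟩
    refine ⟨f * translate s⁻¹ g, mul_mem hf (hD _ g hg), s * t, ?_⟩
    rw [← mulOp_mul_mulOp, ← transOp_mul_transOp, mul_assoc, ← mul_assoc (transOp Y s),
      transOp_mul_mulOp, mul_assoc, mul_assoc]
  have hstar : star (monomials Γ D) ⊆ monomials Γ D := by
    rintro T ⟨f, hf, s, hT⟩
    refine ⟨translate s⁻¹⁻¹ (star f), hD _ _ (star_mem hf), s⁻¹, ?_⟩
    rw [← transOp_mul_mulOp, ← star_transOp, ← star_mulOp, ← star_mul, ← hT, star_star]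
  rw [NonUnitalStarAlgebra.adjoin_eq_span]
  exact Submodule.span_mono
    ((Subsemigroup.closure_le (S := ⟨monomials Γ D, hmul⟩)).2 (Set.union_subset subset_rfl hstar))

theorem exists_diagonal_eq_of_mem_adjoin (hD : ∀ (g : Γ), ∀ f ∈ D, translate g f ∈ D)
    {T : L2 Γ Y →L[ℂ] L2 Γ Y} (hT : T ∈ NonUnitalStarAlgebra.adjoin ℂ (monomials Γ D)) :
    ∃ f ∈ D, diagonal Γ Y T = f := by
  have hspan := adjoin_monomials_le_span hD hT
  clear hT
  induction hspan using Submodule.span_induction with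
  | mem _ h =>
    obtain ⟨f, hf, s, rfl⟩ := h
    obtain rfl | hs := eq_or_ne s 1
    · exact ⟨f, hf, by rw [transOp_one, mul_one, diagonal_mulOp]⟩
    · exact ⟨0, zero_mem D, diagonal_mulOp_mul_transOp f hs⟩
  | zero => exact ⟨0, zero_mem D, map_zero _⟩
  | add _ _ _ _ h h' =>
    obtain ⟨f, hf, hf'⟩ := h
    obtain ⟨g, hg, hg'⟩ := h'
    exact ⟨f + g, add_mem hf hg, by rw [map_add, hf', hg']; rfl⟩
  | smul r _ _ h =>
    obtain ⟨f, hf, hf'⟩ := h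
    exact ⟨r • f, SMulMemClass.smul_mem r hf, by rw [map_smul, hf']; rfl⟩

theorem mulOp_mem_of_diagonal_eq (hD : ∀ (g : Γ), ∀ f ∈ D, translate g f ∈ D)
    {T : L2 Γ Y →L[ℂ] L2 Γ Y} (hT : T ∈ reducedCrossedProduct Γ D) {f : C₀(Y, ℂ)}
    (hf : diagonal Γ Y T = f) : mulOp Γ f ∈ reducedCrossedProduct Γ D := by
  refine (NonUnitalStarSubalgebra.isClosed_topologicalClosure _).closure_subset
    (Metric.mem_closure_iff.2 fun ε hε => ?_)
  obtain ⟨a, ha, hTa⟩ := Metric.mem_closure_iff.1 hT ε hε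
  obtain ⟨g, hg, hag⟩ := exists_diagonal_eq_of_mem_adjoin hD ha
  have hfg : ‖f - g‖ ≤ ‖T - a‖ :=
    (BoundedContinuousFunction.norm_le (norm_nonneg _)).2 fun y => by
      have h := norm_diagonal_le (T - a) y
      rwa [map_sub, hf, hag] at h
  refine ⟨mulOp Γ g, mulOp_mem_reducedCrossedProduct hg, ?_⟩
  calc dist (mulOp Γ f) (mulOp Γ g) = ‖mulOp Γ (f - g)‖ := by rw [dist_eq_norm, mulOp_sub]
    _ ≤ ‖f - g‖ := norm_mulOp_le _
    _ ≤ dist T a := hfg.trans_eq (dist_eq_norm T a).symm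
    _ < ε := hTa

end Expectation

section OrbitSum

open Asymptotics Filter

variable {Γ Y : Type*} [Group Γ]

/-- The sum of the basis vectors along the piece `h, h s, …, h s ^ (n - 1)` of the coset `h⟨s⟩`, in
the copy of `ℓ²(Γ)` over the point `y`. -/
def orbitSum (s : Γ) (y : Y) (n : ℕ) (h : Γ) : L2 Γ Y :=
  ∑ k ∈ Finset.range n, basisVec (h * s ^ k) y

theorem transOp_orbitSum (s : Γ) (y : Y) (n : ℕ) (g h : Γ) :
    transOp Y g (orbitSum s y n h) = orbitSum s y n (g * h) := by
  simp only [orbitSum, map_sum, transOp_basisVec, mul_assoc]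

theorem mulOp_orbitSum [TopologicalSpace Y] [MulAction Γ Y] {s : Γ} {y : Y} {f : C₀(Y, ℂ)} {h : Γ}
    {r : ℂ} (hf : ∀ k : ℕ, f ((h * s ^ k) • y) = r) (n : ℕ) :
    mulOp Γ f (orbitSum s y n h) = r • orbitSum s y n h := by
  simp only [orbitSum, map_sum, mulOp_basisVec, hf, Finset.smul_sum]

theorem sqrt_le_norm_orbitSum (s : Γ) (y : Y) (n : ℕ) (h : Γ) : √n ≤ ‖orbitSum s y n h‖ := by
  classical
  refine Real.sqrt_le_iff.2 ⟨norm_nonneg _, ?_⟩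
  rw [@norm_sq_eq_re_inner ℂ]
  simp only [orbitSum, sum_inner, inner_sum, inner_basisVec_basisVec, map_sum]
  calc (n : ℝ) = ∑ _k ∈ Finset.range n, (1 : ℝ) := by simp
    _ ≤ ∑ k ∈ Finset.range n, ∑ j ∈ Finset.range n,
          RCLike.re (if h * s ^ j = h * s ^ k then (1 : ℂ) else 0) := by
      refine Finset.sum_le_sum fun k hk => ?_
      refine le_trans (by simp) (Finset.single_le_sum (fun j _ => ?_) hk)
      split_ifs <;> simp

theorem tendsto_norm_orbitSum (s : Γ) (y : Y) (h : Γ) :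
    Tendsto (fun n => ‖orbitSum s y n h‖) atTop atTop :=
  tendsto_atTop_mono (fun n => sqrt_le_norm_orbitSum s y n h)
    (Real.tendsto_sqrt_atTop.comp tendsto_natCast_atTop_atTop)

theorem norm_orbitSum_sub_orbitSum_mul_le (s : Γ) (y : Y) (n : ℕ) (h : Γ) :
    ‖orbitSum s y n h - orbitSum s y n (h * s)‖ ≤ 2 := by
  have htelescope : orbitSum s y n h - orbitSum s y n (h * s) =
      basisVec h y - basisVec (h * s ^ n) y := by
    simp only [orbitSum, mul_assoc, ← pow_succ', ← Finset.sum_sub_distrib]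
    simpa using Finset.sum_range_sub' (fun k => basisVec (h * s ^ k) y) n
  calc ‖orbitSum s y n h - orbitSum s y n (h * s)‖
      ≤ ‖basisVec h y‖ + ‖basisVec (h * s ^ n) y‖ := htelescope ▸ norm_sub_le _ _
    _ = 2 := by rw [norm_basisVec, norm_basisVec, one_add_one_eq_two]

theorem isBigO_orbitSum_sub {s g h : Γ}
    (hgh : (g : Γ ⧸ Subgroup.zpowers s) = (h : Γ ⧸ Subgroup.zpowers s)) (y : Y) :
    (fun n => orbitSum s y n g - orbitSum s y n h) =O[atTop] fun _ => (1 : ℝ) := by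
  suffices ∀ t ∈ Subgroup.closure {s}, ∀ a,
      (fun n => orbitSum s y n a - orbitSum s y n (a * t)) =O[atTop] fun _ => (1 : ℝ) by
    have h := this _ (Subgroup.zpowers_eq_closure s ▸ QuotientGroup.eq.1 hgh) g
    rwa [mul_inv_cancel_left] at h
  intro t ht
  induction ht using Subgroup.closure_induction with
  | mem t ht =>
    obtain rfl := Set.mem_singleton_iff.1 ht
    exact fun a => .of_bound 2 (.of_forall fun n => by
      simpa using norm_orbitSum_sub_orbitSum_mul_le t y n a)
  | one => exact fun a => (isBigO_zero _ _).congr_left fun n => by rw [mul_one, sub_self]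
  | mul t u _ _ ht hu =>
    exact fun a => by
      simpa only [sub_add_sub_cancel, mul_assoc] using (ht a).add (hu (a * t))
  | inv t _ ht =>
    exact fun a => by simpa only [inv_mul_cancel_right, neg_sub] using (ht (a * t⁻¹)).neg_left

end OrbitSum

section QuasiRegular

open Asymptotics Filter

variable {Γ Y : Type*} [Group Γ]

/-- The approximate embedding of the quasi-regular representation on `ℂ[Γ/⟨s⟩]` into the copy of
`ℓ²(Γ)` over `y`. It is not normalized: the image of a coset has norm at least `√n`. -/
def cosetEmbedding (s : Γ) (y : Y) (n : ℕ) : (Γ ⧸ Subgroup.zpowers s →₀ ℂ) →ₗ[ℂ] L2 Γ Y :=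
  Finsupp.linearCombination ℂ fun q => orbitSum s y n q.out

theorem cosetEmbedding_single (s : Γ) (y : Y) (n : ℕ) (q : Γ ⧸ Subgroup.zpowers s) (r : ℂ) :
    cosetEmbedding s y n (Finsupp.single q r) = r • orbitSum s y n q.out :=
  Finsupp.linearCombination_single ..

theorem norm_cosetEmbedding_eq (s : Γ) (y y' : Y) (n : ℕ) (c : Γ ⧸ Subgroup.zpowers s →₀ ℂ) :
    ‖cosetEmbedding s y n c‖ = ‖cosetEmbedding s y' n c‖ := by
  classical
  have h : inner ℂ (cosetEmbedding s y n c) (cosetEmbedding s y n c) =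
      inner ℂ (cosetEmbedding s y' n c) (cosetEmbedding s y' n c) := by
    simp only [cosetEmbedding, orbitSum, Finsupp.linearCombination_apply, Finsupp.sum, sum_inner,
      inner_sum, inner_smul_left, inner_smul_right, inner_basisVec_basisVec]
  rw [@norm_eq_sqrt_re_inner ℂ, @norm_eq_sqrt_re_inner ℂ, h]

/-- Multiplication by a function `k` on `Γ/⟨s⟩`. -/
def cosetMul {s : Γ} (k : Γ ⧸ Subgroup.zpowers s → ℂ) :
    (Γ ⧸ Subgroup.zpowers s →₀ ℂ) →ₗ[ℂ] (Γ ⧸ Subgroup.zpowers s →₀ ℂ) :=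
  Finsupp.linearCombination ℂ fun q => Finsupp.single q (k q)

theorem cosetMul_single {s : Γ} (k : Γ ⧸ Subgroup.zpowers s → ℂ) (q : Γ ⧸ Subgroup.zpowers s)
    (r : ℂ) : cosetMul k (Finsupp.single q r) = Finsupp.single q (k q * r) := by
  rw [cosetMul, Finsupp.linearCombination_single, Finsupp.smul_single, smul_eq_mul, mul_comm]

/-- The quasi-regular representation of `Γ` on `ℂ[Γ/⟨s⟩]`. -/
def cosetTranslate (s g : Γ) :
    (Γ ⧸ Subgroup.zpowers s →₀ ℂ) →ₗ[ℂ] (Γ ⧸ Subgroup.zpowers s →₀ ℂ) :=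
  Finsupp.lmapDomain ℂ ℂ (g • ·)

theorem cosetTranslate_single (s g : Γ) (q : Γ ⧸ Subgroup.zpowers s) (r : ℂ) :
    cosetTranslate s g (Finsupp.single q r) = Finsupp.single (g • q) r :=
  Finsupp.mapDomain_single

/-- The operator `a` corresponds to `B` under the approximate embedding over `y`, up to an error
that stays bounded while the norms of the embedded vectors tend to infinity. -/
def IsAsymptoticLift (s : Γ) (y : Y) (a : L2 Γ Y →L[ℂ] L2 Γ Y)
    (B : Module.End ℂ (Γ ⧸ Subgroup.zpowers s →₀ ℂ)) : Prop :=
  ∀ c, (fun n => a (cosetEmbedding s y n c) - cosetEmbedding s y n (B c)) =O[atTop]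
    fun _ => (1 : ℝ)

namespace IsAsymptoticLift

variable {s : Γ} {y : Y} {a a' : L2 Γ Y →L[ℂ] L2 Γ Y}
  {B B' : Module.End ℂ (Γ ⧸ Subgroup.zpowers s →₀ ℂ)}

theorem zero : IsAsymptoticLift s y 0 0 := fun _ =>
  (isBigO_zero _ _).congr_left fun n => by simp

theorem add (h : IsAsymptoticLift s y a B) (h' : IsAsymptoticLift s y a' B') :
    IsAsymptoticLift s y (a + a') (B + B') := fun c =>
  ((h c).add (h' c)).congr_left fun n => by
    rw [add_apply, LinearMap.add_apply, map_add]
    abel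

theorem smul (r : ℂ) (h : IsAsymptoticLift s y a B) : IsAsymptoticLift s y (r • a) (r • B) :=
  fun c => ((h c).const_smul_left r).congr_left fun n => by
    simp [smul_sub]

theorem sub_cancel (h : IsAsymptoticLift s y a B) (h' : IsAsymptoticLift s y a' B) :
    IsAsymptoticLift s y (a - a') 0 := fun c =>
  ((h c).sub (h' c)).congr_left fun n => by
    rw [sub_sub_sub_cancel_right, sub_apply, LinearMap.zero_apply, map_zero, sub_zero]

theorem mul (h : IsAsymptoticLift s y a B) (h' : IsAsymptoticLift s y a' B') :
    IsAsymptoticLift s y (a * a') (B * B') := fun c =>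
  (((a.isBigO_comp _ _).trans (h' c)).add (h (B' c))).congr_left fun n => by
    simp

theorem of_single (h : ∀ q, (fun n => a (cosetEmbedding s y n (.single q 1)) -
      cosetEmbedding s y n (B (.single q 1))) =O[atTop] fun _ => (1 : ℝ)) :
    IsAsymptoticLift s y a B := fun c => by
  induction c using Finsupp.induction_linear with
  | zero => exact (isBigO_zero _ _).congr_left fun n => by simp
  | add c d hc hd =>
    refine (hc.add hd).congr_left fun n => ?_
    simp only [map_add]
    abel
  | single q r =>
    refine ((h q).const_smul_left r).congr_left fun n => ?_
    rw [Pi.smul_apply, smul_sub, ← map_smul, ← map_smul, ← map_smul, ← map_smul,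
      Finsupp.smul_single_one]

theorem eventually_norm_sub_le {b : L2 Γ Y →L[ℂ] L2 Γ Y} {ε : ℝ} (h : IsAsymptoticLift s y b B)
    (hab : ‖a - b‖ < ε) (q : Γ ⧸ Subgroup.zpowers s) :
    ∀ᶠ n in atTop, ‖a (cosetEmbedding s y n (.single q 1)) -
      cosetEmbedding s y n (B (.single q 1))‖ ≤ ε * ‖cosetEmbedding s y n (.single q 1)‖ := by
  have hsmall : (fun n => b (cosetEmbedding s y n (.single q 1)) -
      cosetEmbedding s y n (B (.single q 1))) =o[atTop]
        fun n => cosetEmbedding s y n (.single q 1) :=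
    (h _).trans_isLittleO <| (isLittleO_const_left).2 <| .inr <| by
      simpa only [Function.comp_def, cosetEmbedding_single, one_smul] using
        tendsto_norm_orbitSum s y q.out
  filter_upwards [hsmall.bound (sub_pos.2 hab)] with n hn
  set ξ := cosetEmbedding s y n (.single q 1)
  set η := cosetEmbedding s y n (B (.single q 1))
  calc ‖a ξ - η‖ = ‖(a - b) ξ + (b ξ - η)‖ := by rw [sub_apply, sub_add_sub_cancel]
    _ ≤ ‖a - b‖ * ‖ξ‖ + (ε - ‖a - b‖) * ‖ξ‖ := norm_add_le_of_le ((a - b).le_opNorm ξ) hn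
    _ = ε * ‖ξ‖ := by ring

end IsAsymptoticLift

theorem isAsymptoticLift_transOp (s : Γ) (y : Y) (g : Γ) :
    IsAsymptoticLift s y (transOp Y g) (cosetTranslate s g) := .of_single fun q => by
  have hcoset : ((g * q.out : Γ) : Γ ⧸ Subgroup.zpowers s) = ((g • q).out : Γ) := by
    rw [QuotientGroup.out_eq']
    exact MulAction.Quotient.coe_smul_out (H := Subgroup.zpowers s) g q
  simpa only [cosetTranslate_single, cosetEmbedding_single, one_smul, transOp_orbitSum] using
    isBigO_orbitSum_sub hcoset y

theorem isAsymptoticLift_mulOp [TopologicalSpace Y] [MulAction Γ Y] {s : Γ} {y : Y} {f : C₀(Y, ℂ)}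
    {k : Γ ⧸ Subgroup.zpowers s → ℂ} (hf : ∀ t : Γ, f (t • y) = k t) :
    IsAsymptoticLift s y (mulOp Γ f) (cosetMul k) := .of_single fun q => by
  have hk : ∀ j : ℕ, f ((q.out * s ^ j) • y) = k q := fun j => by
    rw [hf, QuotientGroup.mk_mul_of_mem _ (Subgroup.npow_mem_zpowers s j), QuotientGroup.out_eq']
  refine (isBigO_zero _ _).congr_left fun n => ?_
  rw [cosetMul_single, cosetEmbedding_single, cosetEmbedding_single, one_smul, mul_one,
    mulOp_orbitSum hk, sub_self]

/-- The operators which correspond to the same operator on `ℂ[Γ/⟨s⟩]` over `y₁` and over `y₂`, and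
whose adjoints have the same property. -/
def commonLifts (s : Γ) (y₁ y₂ : Y) : NonUnitalStarSubalgebra ℂ (L2 Γ Y →L[ℂ] L2 Γ Y) where
  carrier := {a | (∃ B, IsAsymptoticLift s y₁ a B ∧ IsAsymptoticLift s y₂ a B) ∧
    ∃ B, IsAsymptoticLift s y₁ (star a) B ∧ IsAsymptoticLift s y₂ (star a) B}
  zero_mem' := ⟨⟨0, .zero, .zero⟩, 0, by simpa only [star_zero] using ⟨.zero, .zero⟩⟩
  add_mem' := by
    rintro a b ⟨⟨A, h₁, h₂⟩, A', h₁', h₂'⟩ ⟨⟨B, k₁, k₂⟩, B', k₁', k₂'⟩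
    exact ⟨⟨A + B, h₁.add k₁, h₂.add k₂⟩, A' + B', by
      simpa only [star_add] using ⟨h₁'.add k₁', h₂'.add k₂'⟩⟩
  smul_mem' := by
    rintro r a ⟨⟨A, h₁, h₂⟩, A', h₁', h₂'⟩
    exact ⟨⟨r • A, h₁.smul r, h₂.smul r⟩, star r • A', by
      simpa only [star_smul] using ⟨h₁'.smul (star r), h₂'.smul (star r)⟩⟩
  mul_mem' := by
    rintro a b ⟨⟨A, h₁, h₂⟩, A', h₁', h₂'⟩ ⟨⟨B, k₁, k₂⟩, B', k₁', k₂'⟩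
    exact ⟨⟨A * B, h₁.mul k₁, h₂.mul k₂⟩, B' * A', by
      simpa only [star_mul] using ⟨k₁'.mul h₁', k₂'.mul h₂'⟩⟩
  star_mem' := by
    rintro a ⟨h, h'⟩
    exact ⟨h', by rwa [star_star]⟩

theorem notMem_closure_commonLifts {s : Γ} {y₁ y₂ : Y} {a : L2 Γ Y →L[ℂ] L2 Γ Y}
    {B : Module.End ℂ (Γ ⧸ Subgroup.zpowers s →₀ ℂ)} {q : Γ ⧸ Subgroup.zpowers s}
    (h₁ : IsAsymptoticLift s y₁ a 0) (h₂ : IsAsymptoticLift s y₂ a B)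
    (hB : B (.single q 1) = .single q 1) :
    a ∉ closure (commonLifts s y₁ y₂ : Set (L2 Γ Y →L[ℂ] L2 Γ Y)) := by
  intro ha
  obtain ⟨b, ⟨⟨B', hb₁, hb₂⟩, -⟩, hab⟩ := Metric.mem_closure_iff.1 ha (1 / 5) (by norm_num)
  rw [dist_eq_norm] at hab
  have haa : ‖a - a‖ < 1 / 5 := by norm_num
  obtain ⟨n, h₁, h₂, hb₁, hb₂, hn⟩ := ((h₁.eventually_norm_sub_le haa q).and <|
    (h₂.eventually_norm_sub_le haa q).and <| (hb₁.eventually_norm_sub_le hab q).and <|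
    (hb₂.eventually_norm_sub_le hab q).and <|
    (tendsto_norm_orbitSum s y₂ q.out).eventually_gt_atTop 0).exists
  have hzero : ‖cosetEmbedding s y₂ n (B' (.single q 1))‖ ≤
      2 / 5 * ‖cosetEmbedding s y₂ n (.single q 1)‖ := by
    rw [LinearMap.zero_apply, map_zero, sub_zero] at h₁
    rw [norm_cosetEmbedding_eq s y₂ y₁, norm_cosetEmbedding_eq s y₂ y₁]
    linarith [norm_le_norm_add_norm_sub' (cosetEmbedding s y₁ n (B' (.single q 1)))
      (a (cosetEmbedding s y₁ n (.single q 1))),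
      norm_sub_rev (a (cosetEmbedding s y₁ n (.single q 1)))
        (cosetEmbedding s y₁ n (B' (.single q 1)))]
  have hone : ‖cosetEmbedding s y₂ n (.single q 1) - cosetEmbedding s y₂ n (B' (.single q 1))‖ ≤
      2 / 5 * ‖cosetEmbedding s y₂ n (.single q 1)‖ := by
    rw [hB, norm_sub_rev] at h₂
    linarith [norm_sub_le_norm_sub_add_norm_sub (cosetEmbedding s y₂ n (.single q 1))
      (a (cosetEmbedding s y₂ n (.single q 1))) (cosetEmbedding s y₂ n (B' (.single q 1)))]
  have hpos : 0 < ‖cosetEmbedding s y₂ n (.single q 1)‖ := by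
    rwa [cosetEmbedding_single, one_smul]
  linarith [norm_le_norm_add_norm_sub' (cosetEmbedding s y₂ n (.single q 1))
    (cosetEmbedding s y₂ n (B' (.single q 1)))]

end QuasiRegular

section Intermediate

variable {Γ Y : Type*} [Group Γ] {s : Γ}

/-- The projection of `ℂ[Γ/⟨s⟩]` onto the line spanned by the coset `⟨s⟩`. -/
def baseProj (s : Γ) : Module.End ℂ (Γ ⧸ Subgroup.zpowers s →₀ ℂ) :=
  cosetMul (Set.indicator {((1 : Γ) : Γ ⧸ Subgroup.zpowers s)} 1)

theorem baseProj_single_one :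
    baseProj s (.single ((1 : Γ) : Γ ⧸ Subgroup.zpowers s) 1) = .single ((1 : Γ) : Γ ⧸ _) 1 := by
  simp [baseProj, cosetMul_single]

theorem smul_eq_mk_one_iff {g : Γ} (hg : g ∈ Subgroup.zpowers s) (q : Γ ⧸ Subgroup.zpowers s) :
    g • q = ((1 : Γ) : Γ ⧸ Subgroup.zpowers s) ↔ q = ((1 : Γ) : Γ ⧸ Subgroup.zpowers s) := by
  have hfix : g • ((1 : Γ) : Γ ⧸ Subgroup.zpowers s) = ((1 : Γ) : Γ ⧸ Subgroup.zpowers s) :=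
    QuotientGroup.eq.2 (by simpa using hg)
  nth_rw 1 [← hfix]
  exact smul_left_cancel_iff g

theorem baseProj_mul_cosetTranslate {g : Γ} (hg : g ∈ Subgroup.zpowers s) :
    baseProj s * cosetTranslate s g = baseProj s := by
  refine Finsupp.lhom_ext fun q r => ?_
  rw [Module.End.mul_apply, cosetTranslate_single, baseProj, cosetMul_single, cosetMul_single]
  by_cases hq : q = ((1 : Γ) : Γ ⧸ Subgroup.zpowers s)
  · rw [(smul_eq_mk_one_iff hg q).2 hq, hq]
  · simp [hq, smul_eq_mk_one_iff hg]

theorem cosetTranslate_mul_baseProj {g : Γ} (hg : g ∈ Subgroup.zpowers s) :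
    cosetTranslate s g * baseProj s = baseProj s := by
  refine Finsupp.lhom_ext fun q r => ?_
  rw [Module.End.mul_apply, baseProj, cosetMul_single, cosetTranslate_single]
  by_cases hq : q = ((1 : Γ) : Γ ⧸ Subgroup.zpowers s)
  · rw [(smul_eq_mk_one_iff hg q).2 hq, hq]
  · simp [hq]

variable [TopologicalSpace Y] [MulAction Γ Y] {y₁ y₂ : Y} {p : C₀(Y, ℂ)}
  {D D' : NonUnitalStarSubalgebra ℂ C₀(Y, ℂ)}

/-- The function `p` vanishes on the orbit of `y₁` and restricts to the indicator function of
`⟨s⟩ y₂` on the orbit of `y₂`. -/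
structure IsOrbitCutoff (s : Γ) (y₁ y₂ : Y) (p : C₀(Y, ℂ)) : Prop where
  apply_smul_left : ∀ t : Γ, p (t • y₁) = 0
  apply_smul_right : ∀ t : Γ, p (t • y₂) = Set.indicator (Subgroup.zpowers s : Set Γ) 1 t

namespace IsOrbitCutoff

theorem star (h : IsOrbitCutoff s y₁ y₂ p) : IsOrbitCutoff s y₁ y₂ (star p) where
  apply_smul_left t := by simp [h.apply_smul_left]
  apply_smul_right t := by
    by_cases ht : t ∈ Subgroup.zpowers s <;> simp [h.apply_smul_right, ht]

theorem isAsymptoticLift_left (h : IsOrbitCutoff s y₁ y₂ p) :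
    IsAsymptoticLift s y₁ (mulOp Γ p) 0 := by
  have hzero : cosetMul (0 : Γ ⧸ Subgroup.zpowers s → ℂ) = 0 :=
    Finsupp.lhom_ext fun q r => by simp [cosetMul_single]
  exact hzero ▸ isAsymptoticLift_mulOp h.apply_smul_left

theorem isAsymptoticLift_right (h : IsOrbitCutoff s y₁ y₂ p) :
    IsAsymptoticLift s y₂ (mulOp Γ p) (baseProj s) := by
  refine isAsymptoticLift_mulOp fun t => ?_
  have hcoset : (t : Γ ⧸ Subgroup.zpowers s) = (1 : Γ) ↔ t ∈ Subgroup.zpowers s := by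
    rw [eq_comm, QuotientGroup.eq, inv_one, one_mul]
  by_cases ht : t ∈ Subgroup.zpowers s <;> simp [h.apply_smul_right, hcoset, ht]

theorem mulOp_sub_mem_commonLifts (h : IsOrbitCutoff s y₁ y₂ p) :
    mulOp Γ p - mulOp Γ p * transOp Y s ∈ commonLifts s y₁ y₂ := by
  have hs := Subgroup.mem_zpowers s
  refine ⟨⟨0, h.isAsymptoticLift_left.sub_cancel ?_, h.isAsymptoticLift_right.sub_cancel ?_⟩, 0, ?_⟩
  · simpa only [zero_mul] using h.isAsymptoticLift_left.mul (isAsymptoticLift_transOp s y₁ s)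
  · simpa only [baseProj_mul_cosetTranslate hs] using
      h.isAsymptoticLift_right.mul (isAsymptoticLift_transOp s y₂ s)
  rw [star_sub, star_mul, star_mulOp, star_transOp]
  refine ⟨h.star.isAsymptoticLift_left.sub_cancel ?_, h.star.isAsymptoticLift_right.sub_cancel ?_⟩
  · simpa only [mul_zero] using
      (isAsymptoticLift_transOp s y₁ s⁻¹).mul h.star.isAsymptoticLift_left
  · simpa only [cosetTranslate_mul_baseProj (inv_mem hs)] using
      (isAsymptoticLift_transOp s y₂ s⁻¹).mul h.star.isAsymptoticLift_right

end IsOrbitCutoff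

/-- The functions in `D` take the same values along the orbits of `y₁` and `y₂`, and these values
only depend on the coset in `Γ/⟨s⟩`. -/
def AgreeOnCosets (s : Γ) (y₁ y₂ : Y) (D : NonUnitalStarSubalgebra ℂ C₀(Y, ℂ)) : Prop :=
  ∀ f ∈ D, ∃ k : Γ ⧸ Subgroup.zpowers s → ℂ, ∀ t : Γ, f (t • y₁) = k t ∧ f (t • y₂) = k t

theorem agreeOnCosets_pullback {X : Type*} [TopologicalSpace X] [MulAction Γ X] {π : Y → X}
    (hπ : ∀ (t : Γ) (y : Y), π (t • y) = t • π y) {x : X} (hx : s • x = x) (h₁ : π y₁ = x)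
    (h₂ : π y₂ = x) : AgreeOnCosets s y₁ y₂ (pullback π) := by
  rintro f ⟨k, hk⟩
  have hstab : Subgroup.zpowers s ≤ MulAction.stabilizer Γ x := by
    rwa [Subgroup.zpowers_le, MulAction.mem_stabilizer_iff]
  have hout (t : Γ) : (t : Γ ⧸ Subgroup.zpowers s).out • x = t • x := by
    obtain ⟨u, hu⟩ := QuotientGroup.mk_out_eq_mul (Subgroup.zpowers s) t
    rw [hu, mul_smul, hstab u.2]
  exact ⟨fun q => k (q.out • x), fun t =>
    ⟨by simp only [hk, hπ, h₁, hout], by simp only [hk, hπ, h₂, hout]⟩⟩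

theorem AgreeOnCosets.monomials_subset_commonLifts (hD : AgreeOnCosets s y₁ y₂ D) :
    monomials Γ D ⊆ commonLifts s y₁ y₂ := by
  rintro _ ⟨f, hf, g, rfl⟩
  obtain ⟨k, hk⟩ := hD f hf
  obtain ⟨k', hk'⟩ := hD (star f) (star_mem hf)
  refine ⟨⟨_, (isAsymptoticLift_mulOp fun t => (hk t).1).mul (isAsymptoticLift_transOp s y₁ g),
    (isAsymptoticLift_mulOp fun t => (hk t).2).mul (isAsymptoticLift_transOp s y₂ g)⟩, ?_⟩
  rw [star_mul, star_mulOp, star_transOp]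
  exact ⟨_, (isAsymptoticLift_transOp s y₁ g⁻¹).mul (isAsymptoticLift_mulOp fun t => (hk' t).1),
    (isAsymptoticLift_transOp s y₂ g⁻¹).mul (isAsymptoticLift_mulOp fun t => (hk' t).2)⟩

/-- The C*-algebra generated by `D ⋊_r Γ` and the element `p - p u_s`. -/
def intermediateAlgebra (s : Γ) (p : C₀(Y, ℂ)) (D : NonUnitalStarSubalgebra ℂ C₀(Y, ℂ)) :
    NonUnitalStarSubalgebra ℂ (L2 Γ Y →L[ℂ] L2 Γ Y) :=
  (NonUnitalStarAlgebra.adjoin ℂ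
    (insert (mulOp Γ p - mulOp Γ p * transOp Y s) (monomials Γ D))).topologicalClosure

theorem mulOp_sub_mem_intermediateAlgebra (s : Γ) (p : C₀(Y, ℂ))
    (D : NonUnitalStarSubalgebra ℂ C₀(Y, ℂ)) :
    mulOp Γ p - mulOp Γ p * transOp Y s ∈ intermediateAlgebra s p D :=
  NonUnitalStarSubalgebra.le_topologicalClosure _
    (NonUnitalStarAlgebra.subset_adjoin ℂ _ (Set.mem_insert _ _))

theorem reducedCrossedProduct_le_intermediateAlgebra (s : Γ) (p : C₀(Y, ℂ))
    (D : NonUnitalStarSubalgebra ℂ C₀(Y, ℂ)) :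
    reducedCrossedProduct Γ D ≤ intermediateAlgebra s p D :=
  NonUnitalStarSubalgebra.topologicalClosure_mono
    (NonUnitalStarAlgebra.adjoin_mono (Set.subset_insert _ _))

theorem intermediateAlgebra_le_reducedCrossedProduct (hp : p ∈ D') (hD : D ≤ D') :
    intermediateAlgebra s p D ≤ reducedCrossedProduct Γ D' := by
  refine NonUnitalStarSubalgebra.topologicalClosure_minimal _
    (NonUnitalStarAlgebra.adjoin_le (Set.insert_subset ?_ ?_))
    (NonUnitalStarSubalgebra.isClosed_topologicalClosure _)
  · exact sub_mem (mulOp_mem_reducedCrossedProduct hp)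
      (mulOp_mul_transOp_mem_reducedCrossedProduct hp s)
  · rintro _ ⟨f, hf, g, rfl⟩
    exact mulOp_mul_transOp_mem_reducedCrossedProduct (hD hf) g

theorem IsOrbitCutoff.mulOp_notMem_intermediateAlgebra (hp : IsOrbitCutoff s y₁ y₂ p)
    (hD : AgreeOnCosets s y₁ y₂ D) : mulOp Γ p ∉ intermediateAlgebra s p D := by
  have hgen : NonUnitalStarAlgebra.adjoin ℂ
      (insert (mulOp Γ p - mulOp Γ p * transOp Y s) (monomials Γ D)) ≤ commonLifts s y₁ y₂ :=
    NonUnitalStarAlgebra.adjoin_le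
      (Set.insert_subset hp.mulOp_sub_mem_commonLifts hD.monomials_subset_commonLifts)
  exact fun h => notMem_closure_commonLifts hp.isAsymptoticLift_left hp.isAsymptoticLift_right
    baseProj_single_one (closure_mono hgen h)

theorem intermediateAlgebra_ne_reducedCrossedProduct [ContinuousConstSMul Γ Y] (hs : s ≠ 1)
    (hp : mulOp Γ p ∉ intermediateAlgebra s p D)
    (hD' : ∀ (g : Γ), ∀ f ∈ D', translate g f ∈ D') :
    intermediateAlgebra s p D ≠ reducedCrossedProduct Γ D' := fun h =>
  have hdiag : diagonal Γ Y (mulOp Γ p - mulOp Γ p * transOp Y s) = p := by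
    rw [map_sub, diagonal_mulOp, diagonal_mulOp_mul_transOp p hs, sub_zero]
  hp <| h ▸ mulOp_mem_of_diagonal_eq hD' (h ▸ mulOp_sub_mem_intermediateAlgebra s p D) hdiag

end Intermediate

section FreeCover

/-- The full shift over the alphabet `α`: the group `Γ` acts on the functions `Γ → α` by left
translation. -/
def FullShift (Γ α : Type*) : Type _ :=
  Γ → α

namespace FullShift

variable {Γ α : Type*}

instance [Group Γ] : MulAction Γ (FullShift Γ α) :=
  arrowAction

theorem smul_apply [Group Γ] (g : Γ) (b : FullShift Γ α) (t : Γ) : (g • b) t = b (g⁻¹ * t) :=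
  rfl

instance [Nonempty α] : Nonempty (FullShift Γ α) :=
  inferInstanceAs (Nonempty (Γ → α))

variable [TopologicalSpace α]

instance : TopologicalSpace (FullShift Γ α) :=
  inferInstanceAs (TopologicalSpace (Γ → α))

instance [T2Space α] : T2Space (FullShift Γ α) :=
  inferInstanceAs (T2Space (Γ → α))

instance [CompactSpace α] : CompactSpace (FullShift Γ α) :=
  inferInstanceAs (CompactSpace (Γ → α))

theorem continuous_eval (t : Γ) : Continuous fun b : FullShift Γ α => b t :=
  continuous_apply t

instance [Group Γ] : ContinuousConstSMul Γ (FullShift Γ α) where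
  continuous_const_smul g := continuous_pi fun t => continuous_eval (g⁻¹ * t)

end FullShift

variable {Γ : Type*} [Group Γ]

theorem exists_cyclic_coloring {s : Γ} {m : ℕ} (hm : m ∣ orderOf s) :
    ∃ c : Γ → ZMod m, ∀ t, c (t * s) = c t + 1 := by
  have hmem (t : Γ) : (t : Γ ⧸ Subgroup.zpowers s).out⁻¹ * t ∈ Subgroup.zpowers s :=
    QuotientGroup.eq.1 (QuotientGroup.out_eq' _)
  choose n hn using fun t => Subgroup.mem_zpowers_iff.1 (hmem t)
  refine ⟨fun t => (n t : ZMod m), fun t => ?_⟩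
  have hpow : s ^ n (t * s) = s ^ (n t + 1) := by
    rw [hn, QuotientGroup.mk_mul_of_mem _ (Subgroup.mem_zpowers s), ← mul_assoc, ← hn,
      zpow_add_one]
  have hmod := (zpow_eq_zpow_iff_modEq.1 hpow).of_dvd (Int.natCast_dvd_natCast.2 hm)
  simpa only [Int.cast_add, Int.cast_one] using (ZMod.intCast_eq_intCast_iff _ _ _).2 hmod

instance (n : ℕ) : NeZero n.minFac :=
  ⟨n.minFac_pos.ne'⟩

/-- The compact space of families of colourings of `Γ`, one for each `s : Γ`, in which the `s`-th
colour goes up by one under right multiplication by `s`. The number of colours for `s` divides the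
order of `s` and is only `1` for `s = 1`; it is `2` if `s` has infinite order, since
`Nat.minFac 0 = 2`. -/
def CyclicColoring (Γ : Type*) [Group Γ] : Type _ :=
  {c : FullShift Γ (∀ s : Γ, ZMod (orderOf s).minFac) // ∀ s t, c (t * s) s = c t s + 1}

namespace CyclicColoring

instance : MulAction Γ (CyclicColoring Γ) where
  smul g c := ⟨g • c.1, fun s t => by
    rw [FullShift.smul_apply, FullShift.smul_apply, ← mul_assoc, c.2]⟩
  one_smul c := Subtype.ext (one_smul Γ c.1)
  mul_smul g h c := Subtype.ext (mul_smul g h c.1)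

theorem isFreeAction : IsFreeAction Γ (CyclicColoring Γ) := by
  intro s c hc
  have hfix : c.1 (s⁻¹ * s) s = c.1 s s :=
    congrFun (congrFun (congrArg Subtype.val hc) s) s
  have hstep : c.1 s s = c.1 1 s + 1 := by rw [← c.2, one_mul]
  rw [inv_mul_cancel, hstep, left_eq_add] at hfix
  rwa [ZMod.one_eq_zero_iff, Nat.minFac_eq_one_iff, orderOf_eq_one_iff] at hfix

instance : Nonempty (CyclicColoring Γ) := by
  choose c hc using fun s : Γ => exists_cyclic_coloring (orderOf s).minFac_dvd
  exact ⟨fun t s => c s t, hc⟩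

instance : TopologicalSpace (CyclicColoring Γ) :=
  instTopologicalSpaceSubtype

instance : T2Space (CyclicColoring Γ) :=
  inferInstanceAs (T2Space (Subtype _))

instance : CompactSpace (CyclicColoring Γ) := by
  have hcont (s t : Γ) :
      Continuous fun c : FullShift Γ (∀ s : Γ, ZMod (orderOf s).minFac) => c t s :=
    (continuous_apply s).comp (FullShift.continuous_eval t)
  have hclosed : IsClosed {c : FullShift Γ (∀ s : Γ, ZMod (orderOf s).minFac) |
      ∀ s t, c (t * s) s = c t s + 1} := by
    simp only [Set.ofPred_forall]
    exact isClosed_iInter fun s => isClosed_iInter fun t =>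
      isClosed_eq (hcont s (t * s)) ((hcont s t).add continuous_const)
  exact isCompact_iff_compactSpace.1 hclosed.isCompact

instance : ContinuousConstSMul Γ (CyclicColoring Γ) where
  continuous_const_smul g :=
    ((continuous_const_smul g).comp continuous_subtype_val).subtype_mk _

end CyclicColoring

theorem IsFreeAction.prod_left {X Y : Type*} [MulAction Γ X] [MulAction Γ Y]
    (h : IsFreeAction Γ X) : IsFreeAction Γ (X × Y) :=
  fun s z hz => h s z.1 (congrArg Prod.fst hz)

theorem IsFreeAction.prod_right {X Y : Type*} [MulAction Γ X] [MulAction Γ Y]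
    (h : IsFreeAction Γ Y) : IsFreeAction Γ (X × Y) :=
  fun s z hz => h s z.2 (congrArg Prod.snd hz)

theorem isProperFactorMap_fst {X K : Type*} [MulAction Γ X] [MulAction Γ K] [TopologicalSpace X]
    [TopologicalSpace K] [CompactSpace K] [Nonempty K] :
    IsProperFactorMap Γ (Prod.fst : X × K → X) where
  isQuotientMap := isQuotientMap_fst
  equivariant _ _ := rfl
  isCompact_preimage L hL := by
    simpa only [Set.prod_univ] using hL.prod (isCompact_univ (X := K))

theorem exists_zeroAtInfty_eqOn_one_eqOn_zero {Y : Type*} [TopologicalSpace Y] [RegularSpace Y]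
    [LocallyCompactSpace Y] {K C : Set Y} (hK : IsCompact K) (hC : IsClosed C)
    (hKC : Disjoint K C) : ∃ p : C₀(Y, ℂ), Set.EqOn p 1 K ∧ Set.EqOn p 0 C := by
  obtain ⟨f, hf₁, hf₀, hfc, -⟩ := exists_continuous_one_zero_of_isCompact hK hC hKC
  refine ⟨⟨⟨fun y => (f y : ℂ), by fun_prop⟩,
    (hfc.comp_left (g := fun r : ℝ => (r : ℂ)) Complex.ofReal_zero).is_zero_at_infty⟩,
    fun y hy => ?_, fun y hy => ?_⟩
  · exact congrArg Complex.ofReal (hf₁ hy)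
  · exact congrArg Complex.ofReal (hf₀ hy)

/-- The free `Γ`-space over `X` on which the theorem is realized: the colourings make the action
free, and the shift over `Bool` separates points in the same fibre over `X`. -/
abbrev FreeCover (Γ X : Type*) [Group Γ] : Type _ :=
  X × CyclicColoring Γ × FullShift Γ Bool

theorem exists_isOrbitCutoff {X : Type*} [TopologicalSpace X] [T2Space X] [LocallyCompactSpace X]
    [MulAction Γ X] {s : Γ} {x : X} (hs : s • x = x) :
    ∃ (y₁ y₂ : FreeCover Γ X) (p : C₀(FreeCover Γ X, ℂ)),
      y₁.1 = x ∧ y₂.1 = x ∧ IsOrbitCutoff s y₁ y₂ p := by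
  classical
  obtain ⟨c⟩ := (inferInstance : Nonempty (CyclicColoring Γ))
  have hcont : Continuous fun z : FreeCover Γ X => z.2.2 1 :=
    (FullShift.continuous_eval 1).comp (continuous_snd.comp continuous_snd)
  have hK : IsCompact {z : FreeCover Γ X | z.1 = x ∧ z.2.2 1 = true} :=
    (isProperFactorMap_fst (Γ := Γ).isCompact_preimage {x} isCompact_singleton).inter_right
      (isClosed_singleton.preimage hcont)
  have hC : IsClosed {z : FreeCover Γ X | z.2.2 1 = false} := isClosed_singleton.preimage hcont
  obtain ⟨p, hp₁, hp₀⟩ := exists_zeroAtInfty_eqOn_one_eqOn_zero hK hC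
    (Set.disjoint_left.2 fun z hz hz' => by simp [hz.2] at hz')
  refine ⟨(x, c, fun _ => false), (x, c, fun t => t ∈ Subgroup.zpowers s), p, rfl, rfl,
    fun t => hp₀ rfl, fun t => ?_⟩
  have heval : t⁻¹ * 1 ∈ Subgroup.zpowers s ↔ t ∈ Subgroup.zpowers s := by
    rw [mul_one, inv_mem_iff]
  have hstab : Subgroup.zpowers s ≤ MulAction.stabilizer Γ x := by
    rwa [Subgroup.zpowers_le, MulAction.mem_stabilizer_iff]
  by_cases ht : t ∈ Subgroup.zpowers s
  · rw [Set.indicator_of_mem ht]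
    exact hp₁ ⟨hstab ht, decide_eq_true (heval.2 ht)⟩
  · rw [Set.indicator_of_notMem ht]
    exact hp₀ (decide_eq_false (mt heval.1 ht))

end FreeCover

end CrossedProduct

end

open CrossedProduct in
theorem proposition2p6_general {Γ : Type u} [Group Γ] {X : Type v} [TopologicalSpace X]
    [T2Space X] [LocallyCompactSpace X] [MulAction Γ X] [ContinuousConstSMul Γ X]
    (hX : ¬ IsFreeAction Γ X) :
    ∃ (Y : Type (max u v)) (_ : TopologicalSpace Y) (_ : T2Space Y) (_ : LocallyCompactSpace Y)
      (_ : MulAction Γ Y) (_ : ContinuousConstSMul Γ Y) (π : Y → X),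
      IsFreeAction Γ Y ∧ IsProperFactorMap Γ π ∧
      ∃ A : NonUnitalStarSubalgebra ℂ (L2 Γ Y →L[ℂ] L2 Γ Y),
        IsClosed (A : Set (L2 Γ Y →L[ℂ] L2 Γ Y)) ∧
        reducedCrossedProduct Γ (pullback π) ≤ A ∧ A ≤ reducedCrossedProduct Γ ⊤ ∧
        ∀ D : NonUnitalStarSubalgebra ℂ C₀(Y, ℂ), (∀ (g : Γ), ∀ f ∈ D, translate g f ∈ D) →
          A ≠ reducedCrossedProduct Γ D := by
  obtain ⟨s, x, hx, hs⟩ : ∃ (s : Γ) (x : X), s • x = x ∧ s ≠ 1 := by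
    simpa only [IsFreeAction, not_forall, exists_prop] using hX
  obtain ⟨y₁, y₂, p, h₁, h₂, hp⟩ := exists_isOrbitCutoff hx
  have hagree : AgreeOnCosets s y₁ y₂ (pullback (Prod.fst : FreeCover Γ X → X)) :=
    agreeOnCosets_pullback (fun _ _ => rfl) hx h₁ h₂
  have hle : intermediateAlgebra s p (pullback Prod.fst) ≤ reducedCrossedProduct Γ ⊤ :=
    intermediateAlgebra_le_reducedCrossedProduct NonUnitalStarAlgebra.mem_top
      fun _ _ => NonUnitalStarAlgebra.mem_top
  refine ⟨FreeCover Γ X, inferInstance, inferInstance, inferInstance, inferInstance, inferInstance,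
    Prod.fst, CyclicColoring.isFreeAction.prod_left.prod_right, isProperFactorMap_fst,
    intermediateAlgebra s p (pullback Prod.fst),
    NonUnitalStarSubalgebra.isClosed_topologicalClosure _,
    reducedCrossedProduct_le_intermediateAlgebra s p _, hle, fun D hD =>
    intermediateAlgebra_ne_reducedCrossedProduct hs (hp.mulOp_notMem_intermediateAlgebra hagree) hD⟩

theorem proposition2p6 {Γ : Type u} [Group Γ] {X : Type v} [TopologicalSpace X]
    [T2Space X] [LocallyCompactSpace X] [MulAction Γ X] [ContinuousConstSMul Γ X]
    (hX : ¬ CrossedProduct.IsFreeAction Γ X) :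
    ∃ (Y : Type (max u v)) (_ : TopologicalSpace Y) (_ : T2Space Y) (_ : LocallyCompactSpace Y)
      (_ : MulAction Γ Y) (_ : ContinuousConstSMul Γ Y) (π : Y → X),
      CrossedProduct.IsFreeAction Γ Y ∧
      CrossedProduct.IsProperFactorMap Γ π ∧
      ∃ A : NonUnitalStarSubalgebra ℂ (CrossedProduct.L2 Γ Y →L[ℂ] CrossedProduct.L2 Γ Y),
        IsClosed (A : Set (CrossedProduct.L2 Γ Y →L[ℂ] CrossedProduct.L2 Γ Y)) ∧
        CrossedProduct.reducedCrossedProduct Γ (CrossedProduct.pullback π) ≤ A ∧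
        A ≤ CrossedProduct.reducedCrossedProduct Γ
          (⊤ : NonUnitalStarSubalgebra ℂ (ZeroAtInftyContinuousMap Y ℂ)) ∧
        ∀ (Z : Type (max u v)) [TopologicalSpace Z] [T2Space Z] [LocallyCompactSpace Z]
          [MulAction Γ Z] [ContinuousConstSMul Γ Z] (p : Y → Z) (q : Z → X),
          CrossedProduct.IsFactorMap Γ p → CrossedProduct.IsFactorMap Γ q → q ∘ p = π →
          A ≠ CrossedProduct.reducedCrossedProduct Γ (CrossedProduct.pullback p) := by
  obtain ⟨Y, _, _, _, _, _, π, hfree, hπ, A, hA, hle, hle', hne⟩ := proposition2p6_general hX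
  exact ⟨Y, _, ‹_›, ‹_›, _, ‹_›, π, hfree, hπ, A, hA, hle, hle', fun Z _ _ _ _ _ p _ hp _ _ =>
    hne _ fun g _ hf => CrossedProduct.translate_mem_pullback hp.equivariant g hf⟩
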